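/- Let $\mathcal M\subseteq B(H)$ be a von Neumann algebra with a normal faithful finite trace $\tau$, let $\mathcal N\subseteq\mathcal M$ be a (unital) von Neumann subalgebra and let $\mathcal E_{\mathcal N}:\mathcal M\to\mathcal N$ be the $\tau$-preserving normal conditional expectation. Let $(\mathcal A_n)_{n\ge1}$ be von Neumann subalgebras of $\mathcal M$ with $\mathcal N\subseteq\mathcal A_1$ (for instance $\mathcal N\subseteq\mathcal A_n$ for all $n$) that are order independent with respect to $\mathcal E_{\mathcal N}$: for every $n\ge1$, every $a\in\mathcal A_n$ and every $b$ in the von Neumann algebra generated by $\mathcal A_1,\dots,\mathcal A_{n-1}$, $\mathcal E_{\mathcal N}(ab)=\mathcal E_{\mathcal N}(a)\,\mathcal E_{\mathcal N}(b)$. Let $a_n\in\mathcal A_n$ with $\mathcal E_{\mathcal N}(a_n)=0$ for all $n\ge1$. Let $\mathcal M_n$ be the von Neumann algebra generated by $\mathcal A_1,\dots,\mathcal A_n$ and let $\mathcal E_n$ be the $\tau$-preserving conditional expectation onto $\mathcal M_n$, extended to $L^2(\mathcal M,\tau)$ and $L^1(\mathcal M,\tau)$; put $\mathcal E_0=0$.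 For $x\in L^2(\mathcal M,\tau)$ let $$\|x\|_{\mathrm{BMO}_C}=\Bigl(\sup_{n\ge1}\bigl\|\mathcal E_n|x-\mathcal E_{n-1}x|^2\bigr\|_\infty\Bigr)^{1/2}\in[0,\infty],\qquad \|x\|_{\mathrm{BMO}}=\max\bigl\{\|x\|_{\mathrm{BMO}_C},\|x^*\|_{\mathrm{BMO}_C}\bigr\}.$$ Let $\bigl\|\sum_n a_n\bigr\|_{\mathrm{BMO}}$ be the BMO-norm of the sum of the series in $L^2(\mathcal M,\tau)$, and $\infty$ if the series does not converge in $L^2(\mathcal M,\tau)$. A series of positive operators is summed in the strong operator topology, and its norm is $\infty$ if there is no bounded sum. Then, with an absolute constant $C>0$ and as elements of $[0,\infty]$, $$C^{-1}\Bigl\|\sum_{n\ge1}a_n\Bigr\|_{\mathrm{BMO}}\le \sup_{n\ge1}\|a_n\|_\infty+\Bigl\|\Bigl(\sum_{n\ge1}\mathcal E_{\mathcal N}(a_na_n^*+a_n^*a_n)\Bigr)^{1/2}\Bigr\|_\infty\le C\,\Bigl\|\sum_{n\ge1}a_n\Bigr\|_{\mathrm{BMO}}.$$ In particular, if $\mathcal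 N=\mathbb C\mathbf 1$ and $\tau(\mathbf 1)=1$ (so that $\mathcal E_{\mathcal N}=\tau(\cdot)\mathbf 1$), then $$C^{-1}\Bigl\|\sum_{n\ge1}a_n\Bigr\|_{\mathrm{BMO}}\le \sup_{n\ge1}\|a_n\|_\infty+\Bigl(\sum_{n\ge1}\|a_n\|_2^2\Bigr)^{1/2}\le C\,\Bigl\|\sum_{n\ge1}a_n\Bigr\|_{\mathrm{BMO}},\qquad \|a\|_2=\tau(a^*a)^{1/2}.$$ -/

import Mathlib

open scoped ComplexOrder InnerProductSpace ENNReal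

noncomputable section

namespace NCBMO

universe u

variable {H : Type u} [NormedAddCommGroup H] [InnerProductSpace ℂ H] [CompleteSpace H]

/-- The type of elements of a von Neumann algebra `M ⊆ B(H)`, as a unital `*`-algebra over `ℂ`. -/
abbrev El (M : VonNeumannAlgebra H) : Type u := M.toStarSubalgebra

/-- A normal faithful finite trace `τ` on the von Neumann algebra `M`. Here `≤` on `H →L[ℂ] H` is
the usual (Loewner) order of operators, and normality is stated as preservation of suprema of
bounded increasing nets of positive elements. (For such a net in `M`, the supremum among
self-adjoint operators on `H` is the strong limit, so it is also the supremum in `M`.) -/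
structure FiniteTrace (M : VonNeumannAlgebra H) where
  /-- the underlying linear functional -/
  toLin : El M →ₗ[ℂ] ℂ
  nonneg : ∀ x : El M, 0 ≤ (x : H →L[ℂ] H) → 0 ≤ toLin x
  tracial : ∀ x y : El M, toLin (x * y) = toLin (y * x)
  faithful : ∀ x : El M, 0 ≤ (x : H →L[ℂ] H) → toLin x = 0 → x = 0
  normal : ∀ S : Set (El M), S.Nonempty → (∀ x ∈ S, 0 ≤ (x : H →L[ℂ] H)) →
    DirectedOn (fun x y : El M => (x : H →L[ℂ] H) ≤ (y : H →L[ℂ] H)) S →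
    ∀ x : El M, IsLUB ((fun s : El M => (s : H →L[ℂ] H)) '' S) (x : H →L[ℂ] H) →
      IsLUB ((fun s : El M => (toLin s).re) '' S) (toLin x).re

/-- The von Neumann algebra generated by a set `S` of operators: the double commutant of
`S ∪ S*`. -/
def vnGen (S : Set (H →L[ℂ] H)) : VonNeumannAlgebra H where
  toStarSubalgebra := StarSubalgebra.centralizer ℂ (StarSubalgebra.centralizer ℂ S : Set (H →L[ℂ] H))
  centralizer_centralizer' := by
    simp

/-- The trace-preserving conditional expectation of `M` onto the von Neumann subalgebra `N`:
a positive `N`-bimodule projection of `M` onto `N` with `τ ∘ E = τ`.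
(There is exactly one such map; normality and faithfulness are automatic.) -/
structure IsTraceCondExp {M : VonNeumannAlgebra H} (τ : FiniteTrace M) (N : VonNeumannAlgebra H)
    (E : El M →ₗ[ℂ] El M) : Prop where
  le : N ≤ M
  mem : ∀ x : El M, (E x : H →L[ℂ] H) ∈ N
  id_of_mem : ∀ x : El M, (x : H →L[ℂ] H) ∈ N → E x = x
  nonneg : ∀ x : El M, 0 ≤ (x : H →L[ℂ] H) → 0 ≤ (E x : H →L[ℂ] H)
  bimodule : ∀ x y z : El M, (x : H →L[ℂ] H) ∈ N → (z : H →L[ℂ] H) ∈ N →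
    E (x * y * z) = x * E y * z
  trace_preserving : ∀ x : El M, τ.toLin (E x) = τ.toLin x

/-- Order independence of a sequence `A 0, A 1, …` of von Neumann subalgebras of `M` with respect
to `E`: `E (a b) = E a * E b` for `a ∈ A n` and `b` in the von Neumann algebra generated by
the `A k`, `k < n`. -/
structure IsOrderIndependent {M : VonNeumannAlgebra H} (E : El M →ₗ[ℂ] El M)
    (A : ℕ → VonNeumannAlgebra H) : Prop where
  le : ∀ n, A n ≤ M
  map_mul : ∀ n, ∀ a b : El M, (a : H →L[ℂ] H) ∈ A n →
    (b : H →L[ℂ] H) ∈ vnGen (⋃ k ∈ Set.Iio n, (A k : Set (H →L[ℂ] H))) → E (a * b) = E a * E b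

/-- The filtration `n ↦ vN(A 0, …, A n)` of a sequence of von Neumann algebras. -/
def genFiltration (A : ℕ → VonNeumannAlgebra H) (n : ℕ) : VonNeumannAlgebra H :=
  vnGen (⋃ k ∈ Set.Iic n, (A k : Set (H →L[ℂ] H)))

/-! ### The noncommutative `L²`-space -/

section L2

variable {M : VonNeumannAlgebra H} (τ : FiniteTrace M)

set_option linter.unusedVariables false in
/-- The algebra `M`, to be given the inner product `⟪x, y⟫ = τ (x* y)`. -/
@[nolint unusedArguments]
def PreL2 (τ : FiniteTrace M) : Type u := El M

instance : AddCommGroup (PreL2 τ) := inferInstanceAs (AddCommGroup (El M))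
instance : Module ℂ (PreL2 τ) := inferInstanceAs (Module ℂ (El M))

/-- The identity map of `M` into `PreL2`. -/
def toPre : El M ≃ₗ[ℂ] PreL2 τ := LinearEquiv.refl ℂ _

/-- The identity map of `PreL2` into `M`. -/
def ofPre : PreL2 τ ≃ₗ[ℂ] El M := (toPre τ).symm

theorem star_mul_self_nonneg' (x : El M) : 0 ≤ ((star x * x : El M) : H →L[ℂ] H) := by
  simp

theorem FiniteTrace.map_star (x : El M) : τ.toLin (star x) = star (τ.toLin x) := by
  have h0 := (Complex.le_def.1 (τ.nonneg _ (star_mul_self_nonneg' x))).2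
  have h1 := (Complex.le_def.1 (τ.nonneg _ (star_mul_self_nonneg' (1 : El M)))).2
  have h2 := (Complex.le_def.1 (τ.nonneg _ (star_mul_self_nonneg' (x + 1)))).2
  have h3 := (Complex.le_def.1 (τ.nonneg _ (star_mul_self_nonneg' (x + Complex.I • 1)))).2
  simp [mul_add, add_mul] at h0 h1 h2 h3
  apply Complex.ext
  · simp
    linarith
  · simp
    linarith

/-- The inner product `τ (x* y)`; it is definite because `τ` is faithful. -/
abbrev preCore : InnerProductSpace.Core ℂ (PreL2 τ) where
  inner x y := τ.toLin (star (ofPre τ x) * ofPre τ y)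
  conj_inner_symm x y := by
    have := τ.map_star (star (ofPre τ y) * ofPre τ x)
    simp only [star_mul, star_star] at this
    rw [this]; rfl
  re_inner_nonneg x := (Complex.le_def.1 (τ.nonneg _ (star_mul_self_nonneg' (ofPre τ x)))).1
  add_left x y z := by rw [_root_.map_add, star_add, add_mul, _root_.map_add]
  smul_left x y r := by simp
  definite x hx := by
    have h := τ.faithful _ (star_mul_self_nonneg' (ofPre τ x)) hx
    have h' : star (ofPre τ x : H →L[ℂ] H) * (ofPre τ x : H →L[ℂ] H) = 0 := by
      simpa using congrArg (fun z : El M => (z : H →L[ℂ] H)) h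
    have h2 := CStarRing.star_mul_self_eq_zero_iff _ |>.1 h'
    exact (ofPre τ).injective (by rw [_root_.map_zero]; exact Subtype.ext h2)

instance : NormedAddCommGroup (PreL2 τ) :=
  InnerProductSpace.Core.toNormedAddCommGroup (cd := preCore τ)

instance : InnerProductSpace ℂ (PreL2 τ) := InnerProductSpace.ofCore (preCore τ).toCore

theorem inner_def (x y : PreL2 τ) : ⟪x, y⟫_ℂ = τ.toLin (star (ofPre τ x) * ofPre τ y) := rfl

theorem norm_sq_def (x : PreL2 τ) :
    ‖x‖ ^ 2 = (τ.toLin (star (ofPre τ x) * ofPre τ x)).re := by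
  rw [← inner_def, ← inner_self_eq_norm_sq (𝕜 := ℂ)]; rfl

/-- `L²(M, τ)`: the completion of `M` for the norm `‖x‖₂ = τ (x* x)^{1/2}`. -/
abbrev L2 : Type u := UniformSpace.Completion (PreL2 τ)

/-- The inclusion `M ⊆ L²(M, τ)`. -/
def toL2 : El M →ₗ[ℂ] L2 τ :=
  (UniformSpace.Completion.toComplₗᵢ (𝕜 := ℂ) (E := PreL2 τ)).toLinearMap ∘ₗ (toPre τ).toLinearMap

/-- The adjoint `x ↦ x*` on `M`, which is isometric for `‖·‖₂`. -/
def preStar : PreL2 τ →ₗᵢ⋆[ℂ] PreL2 τ where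
  toFun x := toPre τ (star (ofPre τ x))
  map_add' x y := by simp
  map_smul' c x := by simp
  norm_map' x := by
    rw [← sq_eq_sq₀ (norm_nonneg _) (norm_nonneg _), norm_sq_def, norm_sq_def, τ.tracial]
    change (τ.toLin (star (ofPre τ x) * star (star (ofPre τ x)))).re = _
    rw [star_star]

/-- The adjoint `x ↦ x*` on `L²(M, τ)`, the continuous extension of the one of `M`. -/
def starL2 : L2 τ → L2 τ := UniformSpace.Completion.map (preStar τ)

@[simp]
theorem starL2_toL2 (x : El M) : starL2 τ (toL2 τ x) = toL2 τ (star x) :=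
  UniformSpace.Completion.map_coe (preStar τ).isometry.uniformContinuous _

theorem pre_norm_mul_le (x y : El M) :
    ‖toPre τ (x * y)‖ ≤ ‖(y : H →L[ℂ] H)‖ * ‖toPre τ x‖ := by
  rw [← sq_le_sq₀ (norm_nonneg _) (by positivity), mul_pow, norm_sq_def, norm_sq_def]
  change (τ.toLin (star (x * y) * (x * y))).re ≤ _ * (τ.toLin (star x * x)).re
  have h : (0 : H →L[ℂ] H) ≤
      (((‖(y : H →L[ℂ] H)‖ ^ 2 : ℝ) : ℂ) • (x * star x) - x * y * star (x * y) : El M) := by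
    have h1 : (x : H →L[ℂ] H) * ((y : H →L[ℂ] H) * star (y : H →L[ℂ] H)) * star (x : H →L[ℂ] H)
        ≤ ‖(y : H →L[ℂ] H) * star (y : H →L[ℂ] H)‖ •
          ((x : H →L[ℂ] H) * star (x : H →L[ℂ] H)) :=
      CStarAlgebra.star_right_conjugate_le_norm_smul
    rw [CStarRing.norm_self_mul_star, ← sq] at h1
    rw [← sub_nonneg] at h1
    convert h1 using 1
    simp [mul_assoc, ← Complex.coe_smul]
  have h2 := (Complex.le_def.1 (τ.nonneg _ h)).1
  rw [_root_.map_sub, _root_.map_smul, τ.tracial x, τ.tracial (x * y)] at h2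
  rw [smul_eq_mul, Complex.sub_re, Complex.re_ofReal_mul] at h2
  simpa using h2

/-- Right multiplication `x ↦ x y` on `L²(M, τ)` by `y ∈ M`, the continuous extension of the one
of `M`. -/
def rightMul (y : El M) : L2 τ →L[ℂ] L2 τ :=
  (LinearMap.mkContinuous
    ((toPre τ).toLinearMap ∘ₗ LinearMap.mulRight ℂ y ∘ₗ (ofPre τ).toLinearMap)
    ‖(y : H →L[ℂ] H)‖ (fun x => pre_norm_mul_le τ (ofPre τ x) y)).completion

@[simp]
theorem rightMul_toL2 (x y : El M) : rightMul τ y (toL2 τ x) = toL2 τ (x * y) :=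
  ContinuousLinearMap.completion_apply_coe _ _

/-- `τ (|x|² y)` for `x ∈ L²(M, τ)` and `y ∈ M`, that is `⟪x, x y⟫`. The functional
`y ↦ τ (|x|² y)` on `M` represents the element `|x|² = x* x` of `L¹(M, τ)`. -/
def traceSqAbs (x : L2 τ) (y : El M) : ℂ := ⟪x, rightMul τ y x⟫_ℂ

theorem traceSqAbs_toL2 (x y : El M) :
    traceSqAbs τ (toL2 τ x) y = τ.toLin (star x * x * y) := by
  rw [traceSqAbs, rightMul_toL2, mul_assoc]
  exact UniformSpace.Completion.inner_coe _ _

/-- The subspace `L²(N)` of `L²(M, τ)`, for `N ⊆ M`: the closure of `N`. -/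
def L2Sub (N : VonNeumannAlgebra H) : Submodule ℂ (L2 τ) :=
  (((N.toStarSubalgebra.toSubalgebra.toSubmodule).comap
    M.toStarSubalgebra.toSubalgebra.toSubmodule.subtype).map (toL2 τ)).topologicalClosure

instance (N : VonNeumannAlgebra H) : CompleteSpace (L2Sub τ N) :=
  Submodule.topologicalClosure.completeSpace _

/-- The conditional expectation `L²(M, τ) → L²(N)`, that is the orthogonal projection: `E x` is
the element of `L²(N)` with `τ (E x y) = τ (x y)` for all `y ∈ N`. -/
def condExpL2 (N : VonNeumannAlgebra H) : L2 τ →L[ℂ] L2 τ := (L2Sub τ N).starProjection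

/-- `‖E |x|²‖_∞` for `x ∈ L²(M, τ)`, where `E : L¹(M, τ) → L¹(N)` is the trace-preserving
conditional expectation. The element `E |x|²` of `L¹(N)` is determined by
`τ (E |x|² y) = τ (|x|² y)` for all `y ∈ N`. If it is an element `m` of `N`, the value is the
operator norm of `m`, and otherwise it is `∞`. -/
def condExpSqNorm (N : VonNeumannAlgebra H) (x : L2 τ) : ℝ≥0∞ :=
  ⨅ (m : El M) (_ : (m : H →L[ℂ] H) ∈ N ∧
    ∀ y : El M, (y : H →L[ℂ] H) ∈ N → τ.toLin (m * y) = traceSqAbs τ x y), ‖(m : H →L[ℂ] H)‖ₑ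

/-- `E_{n-1}` on `L²(M, τ)` for a filtration `F 0 ⊆ F 1 ⊆ …`, with the convention that the
conditional expectation preceding the first one is `0`. -/
def prevCondExp (F : ℕ → VonNeumannAlgebra H) : ℕ → (L2 τ →L[ℂ] L2 τ)
  | 0 => 0
  | n + 1 => condExpL2 τ (F n)

/-- The column norm `‖x‖_{BMO_C} = (sup_n ‖E_n |x - E_{n-1} x|²‖_∞)^{1/2} ∈ [0, ∞]`. -/
def bmoCol (F : ℕ → VonNeumannAlgebra H) (x : L2 τ) : ℝ≥0∞ :=
  (⨆ n, condExpSqNorm τ (F n) (x - prevCondExp τ F n x)) ^ (1 / 2 : ℝ)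

/-- The row norm `‖x‖_{BMO_R} = ‖x*‖_{BMO_C}`. -/
def bmoRow (F : ℕ → VonNeumannAlgebra H) (x : L2 τ) : ℝ≥0∞ := bmoCol τ F (starL2 τ x)

/-- The norm `‖x‖_{BMO} = max (‖x‖_{BMO_C}, ‖x‖_{BMO_R})` of `x ∈ L²(M, τ)`, equal to `∞` if
`x` is not in `BMO`. -/
def bmo (F : ℕ → VonNeumannAlgebra H) (x : L2 τ) : ℝ≥0∞ := max (bmoCol τ F x) (bmoRow τ F x)

/-- `‖∑ a n‖_{BMO}`: the `BMO`-norm of the sum of the series `∑ a n` in `L²(M, τ)`, and `∞` if the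
series does not converge in `L²(M, τ)`. -/
def bmoOfSeries (F : ℕ → VonNeumannAlgebra H) (a : ℕ → El M) : ℝ≥0∞ :=
  ⨅ (x : L2 τ) (_ : Filter.Tendsto (fun K => ∑ n ∈ Finset.range K, toL2 τ (a n))
    Filter.atTop (nhds x)), bmo τ F x

end L2

/-- `‖(∑ b n)^{1/2}‖_∞` for a sequence of positive operators: the sum is the strong-operator limit
`s` of the partial sums, and the value is `∞` if there is no bounded operator `s`
to which they converge strongly. -/
def sqrtSumNorm (b : ℕ → (H →L[ℂ] H)) : ℝ≥0∞ :=
  ⨅ (s : H →L[ℂ] H) (_ : ∀ ξ : H, Filter.Tendsto (fun K => ∑ n ∈ Finset.range K, b n ξ)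
    Filter.atTop (nhds (s ξ))), ‖CFC.sqrt s‖ₑ

end NCBMO

end

/-!
Write `F n` for the algebra generated by `A 0, …, A n` and `E_n` for the conditional expectation
onto it. Since `N ⊆ F n`, order independence says that an element of `A n` with `E`-expectation
zero is orthogonal to `F m` for `m < n`, and that on `A n` the conditional expectation onto `F m`
is `E` itself. Thus `E_{n-1}` cuts the series `x = ∑ a k` at `k = n`, the mixed terms of
`|∑_{k ≥ n} a k|²` vanish under `E_n`, and

  `E_n |x - E_{n-1} x|² = |a n|² + ∑_{k > n} E |a k|²`,

which `IsCenteredIndep.tendsto_trace_colSquare` states in weak form: the traces of the partial sums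
`colSquare E a n K` against `y ∈ F n` converge to `τ (|x - E_{n-1} x|² y)`.

Both inequalities are read off from this identity, applied to `a` and to `a*`. If `‖a n‖ ≤ B` and
`∑ E |a k|² ≤ c² 1`, then the series converges in `L²`, the right side converges strongly and
normality of `τ` identifies its limit with the left side, so that the column norm is at most
`(B² + c²)^{1/2} ≤ B + c` (`IsCenteredIndep.bmoCol_le`). Conversely, if the left side is an operator
`m ∈ F n`, then every partial sum `b` satisfies `τ (b y) ≤ τ (m y)` for all `y ≥ 0` in `F n`, hence
`b ≤ ‖m‖ 1` (`le_norm_smul_one_of_trace_mul_le`). This bounds `‖a n‖²`, and also `∑ E |a k|²`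
after applying `E` to the identity for `n = 0`; the constant is `1 + 2 = 3`.

For `N = ℂ 1`, both `E |a|²` and `E |a*|²` are `‖a‖₂² 1`, so that the two expressions for the
square function differ by a factor `√2` (`sqrtSumNorm_scalar`).
-/

namespace NCBMO

universe u

variable {H : Type u} [NormedAddCommGroup H] [InnerProductSpace ℂ H]

open Filter Topology

/-! ### Strong limits and functional calculus in a von Neumann algebra -/

theorem nonneg_of_strong_tendsto {T : ℕ → H →L[ℂ] H} {s : H →L[ℂ] H}
    (hT : ∀ᶠ K in atTop, 0 ≤ T K) (h : ∀ ξ, Tendsto (fun K => T K ξ) atTop (𝓝 (s ξ))) :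
    0 ≤ s := by
  rw [ContinuousLinearMap.nonneg_iff_isPositive, ContinuousLinearMap.isPositive_iff_complex]
  intro ξ
  have h1 : Tendsto (fun K => ⟪T K ξ, ξ⟫_ℂ) atTop (𝓝 ⟪s ξ, ξ⟫_ℂ) :=
    (h ξ).inner tendsto_const_nhds
  have h2 : 0 ≤ ⟪s ξ, ξ⟫_ℂ := by
    refine ge_of_tendsto h1 (hT.mono fun K hK => ?_)
    rw [ContinuousLinearMap.nonneg_iff_isPositive] at hK
    exact hK.inner_nonneg_left ξ
  have h3 := Complex.le_def.1 h2
  exact ⟨Complex.ext (by simp) (by simpa using h3.2), by simpa using h3.1⟩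

theorem strong_tendsto_sum_iff {b : ℕ → H →L[ℂ] H} {s : H →L[ℂ] H} :
    (∀ ξ, Tendsto (fun K => ∑ n ∈ Finset.range K, b n ξ) atTop (𝓝 (s ξ))) ↔
      ∀ ξ, Tendsto (fun K => (∑ n ∈ Finset.range K, b n) ξ) atTop (𝓝 (s ξ)) := by
  simp only [_root_.sum_apply]

variable [CompleteSpace H]

theorem mem_of_forall_commute (V : VonNeumannAlgebra H) {x : H →L[ℂ] H}
    (h : ∀ g ∈ V.commutant, Commute g x) : x ∈ V := by
  rw [← V.commutant_commutant, VonNeumannAlgebra.mem_commutant_iff]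
  exact fun g hg => h g hg

theorem commute_of_mem (V : VonNeumannAlgebra H) {x g : H →L[ℂ] H} (hx : x ∈ V)
    (hg : g ∈ V.commutant) : Commute x g :=
  VonNeumannAlgebra.mem_commutant_iff.1 hg x hx

theorem mem_of_strong_tendsto (V : VonNeumannAlgebra H) {T : ℕ → H →L[ℂ] H} {s : H →L[ℂ] H}
    (hT : ∀ K, T K ∈ V) (h : ∀ ξ, Tendsto (fun K => T K ξ) atTop (𝓝 (s ξ))) : s ∈ V := by
  refine mem_of_forall_commute V fun g hg => ?_
  ext ξ
  have h1 : Tendsto (fun K => g (T K ξ)) atTop (𝓝 (g (s ξ))) :=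
    (g.continuous.tendsto _).comp (h ξ)
  refine tendsto_nhds_unique h1 ((h (g ξ)).congr fun K => ?_)
  exact congrArg (fun f : H →L[ℂ] H => f ξ) (commute_of_mem V (hT K) hg).eq

theorem sqrt_mem (V : VonNeumannAlgebra H) {x : H →L[ℂ] H} (hx : x ∈ V) : CFC.sqrt x ∈ V :=
  mem_of_forall_commute V fun _ hg =>
    ((commute_of_mem V hx hg).cfcₙ_nnreal NNReal.sqrt).symm

theorem negPart_mem (V : VonNeumannAlgebra H) {x : H →L[ℂ] H} (hx : x ∈ V) : x⁻ ∈ V :=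
  mem_of_forall_commute V fun _ hg =>
    ((commute_of_mem V hx hg).cfcₙ_real (·⁻)).symm

theorem le_of_strong_tendsto {T : ℕ → H →L[ℂ] H} {s : H →L[ℂ] H} (hT : Monotone T)
    (h : ∀ ξ, Tendsto (fun K => T K ξ) atTop (𝓝 (s ξ))) (J : ℕ) : T J ≤ s := by
  rw [← sub_nonneg]
  refine nonneg_of_strong_tendsto (T := fun K => T K - T J)
    ((eventually_ge_atTop J).mono fun K hK => sub_nonneg.2 (hT hK)) fun ξ => ?_
  simpa using (h ξ).sub_const (T J ξ)

theorem strong_tendsto_le {T : ℕ → H →L[ℂ] H} {s t : H →L[ℂ] H} (hT : ∀ K, T K ≤ t)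
    (h : ∀ ξ, Tendsto (fun K => T K ξ) atTop (𝓝 (s ξ))) : s ≤ t := by
  rw [← sub_nonneg]
  refine nonneg_of_strong_tendsto (T := fun K => t - T K)
    (Eventually.of_forall fun K => sub_nonneg.2 (hT K)) fun ξ => ?_
  simpa using (h ξ).const_sub (t ξ)

theorem norm_le_of_le_smul_one {x : H →L[ℂ] H} {c : ℝ} (hc : 0 ≤ c) (hx : 0 ≤ x)
    (h : x ≤ c • 1) : ‖x‖ ≤ c := by
  rw [CStarAlgebra.norm_le_iff_le_algebraMap x hc hx, Algebra.algebraMap_eq_smul_one]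
  exact h

theorem le_smul_one_of_norm_le {x : H →L[ℂ] H} {c : ℝ} (hx : IsSelfAdjoint x)
    (h : ‖x‖ ≤ c) : x ≤ c • 1 := by
  refine (hx.le_algebraMap_norm_self).trans ?_
  rw [Algebra.algebraMap_eq_smul_one]
  exact smul_le_smul_of_nonneg_right h zero_le_one

theorem norm_sqrt_sq {x : H →L[ℂ] H} (hx : 0 ≤ x) : ‖CFC.sqrt x‖ ^ 2 = ‖x‖ := by
  rw [← (CFC.sqrt_nonneg x).isSelfAdjoint.norm_mul_self, CFC.sqrt_mul_sqrt_self x hx]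

/-- With `r = x^{1/2}` this is `‖r (r ξ)‖² ≤ ‖r‖² ‖r ξ‖²`. -/
theorem norm_apply_sq_le {x : H →L[ℂ] H} (hx : 0 ≤ x) (ξ : H) :
    ‖x ξ‖ ^ 2 ≤ ‖x‖ * (⟪x ξ, ξ⟫_ℂ).re := by
  set r := CFC.sqrt x with hr
  have hrr : r * r = x := CFC.sqrt_mul_sqrt_self x hx
  have hr0 : IsSelfAdjoint r := (CFC.sqrt_nonneg x).isSelfAdjoint
  have hnorm : ‖r‖ ^ 2 = ‖x‖ := norm_sqrt_sq hx
  have h1 : x ξ = r (r ξ) := by rw [← hrr]; rfl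
  have h2 : (⟪x ξ, ξ⟫_ℂ).re = ‖r ξ‖ ^ 2 := by
    rw [h1, ← ContinuousLinearMap.adjoint_inner_right, ← ContinuousLinearMap.star_eq_adjoint,
      hr0.star_eq, inner_self_eq_norm_sq_to_K]
    norm_cast
  rw [h2, h1, ← hnorm, ← mul_pow]
  gcongr
  exact r.le_opNorm _

/-- A bounded increasing sequence of positive operators converges strongly. -/
theorem exists_strong_tendsto {T : ℕ → H →L[ℂ] H} (hT : Monotone T) (h0 : ∀ K, 0 ≤ T K) {c : ℝ}
    (hc : ∀ K, T K ≤ c • 1) :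
    ∃ s : H →L[ℂ] H, ∀ ξ, Tendsto (fun K => T K ξ) atTop (𝓝 (s ξ)) := by
  have hc' : ∀ J K, J ≤ K → ‖T K - T J‖ ≤ |c| := fun J K hJK => by
    refine norm_le_of_le_smul_one (abs_nonneg c) (sub_nonneg.2 (hT hJK)) ?_
    calc T K - T J ≤ T K := sub_le_self _ (h0 J)
      _ ≤ c • 1 := hc K
      _ ≤ |c| • 1 := smul_le_smul_of_nonneg_right (le_abs_self c) zero_le_one
  have hlim : ∀ ξ, ∃ η, Tendsto (fun K => T K ξ) atTop (𝓝 η) := fun ξ => by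
    set f : ℕ → ℝ := fun K => (⟪T K ξ, ξ⟫_ℂ).re with hf
    have hdiff : ∀ J K, f K - f J = (⟪(T K - T J) ξ, ξ⟫_ℂ).re := fun J K => by
      simp [hf]
    have hmono : Monotone f := fun J K hJK => by
      have := (ContinuousLinearMap.nonneg_iff_isPositive _).1 (sub_nonneg.2 (hT hJK))
      rw [← sub_nonneg, hdiff]
      exact (Complex.le_def.1 (this.inner_nonneg_left ξ)).1
    have hbdd : BddAbove (Set.range f) := by
      refine ⟨f 0 + |c| * ‖ξ‖ ^ 2, ?_⟩
      rintro _ ⟨K, rfl⟩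
      have h1 : f K - f 0 ≤ |c| * ‖ξ‖ ^ 2 := by
        rw [hdiff]
        calc _ ≤ ‖⟪(T K - T 0) ξ, ξ⟫_ℂ‖ := Complex.re_le_norm _
          _ ≤ ‖(T K - T 0) ξ‖ * ‖ξ‖ := norm_inner_le_norm _ _
          _ ≤ (|c| * ‖ξ‖) * ‖ξ‖ := by
            gcongr
            exact (T K - T 0).le_of_opNorm_le (hc' 0 K (Nat.zero_le _)) ξ
          _ = _ := by ring
      linarith
    have hcau := (tendsto_atTop_ciSup hmono hbdd).cauchySeq
    refine cauchySeq_tendsto_of_complete (Metric.cauchySeq_iff'.2 fun ε hε => ?_)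
    obtain ⟨J, hJ⟩ := Metric.cauchySeq_iff'.1 hcau (ε ^ 2 / (|c| + 1)) (by positivity)
    refine ⟨J, fun K hK => ?_⟩
    have h1 := hJ K hK
    rw [Real.dist_eq, lt_div_iff₀ (by positivity)] at h1
    rw [dist_eq_norm, ← sq_lt_sq₀ (norm_nonneg _) hε.le]
    have h2 := norm_apply_sq_le (sub_nonneg.2 (hT hK)) ξ
    rw [← hdiff] at h2
    have h3 : 0 ≤ f K - f J := sub_nonneg.2 (hmono hK)
    rw [abs_of_nonneg h3] at h1
    calc ‖T K ξ - T J ξ‖ ^ 2 ≤ ‖T K - T J‖ * (f K - f J) := h2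
      _ ≤ (|c| + 1) * (f K - f J) := by
        gcongr
        linarith [hc' J K hK]
      _ < _ := by linarith
  choose s hs using hlim
  exact ⟨continuousLinearMapOfTendsto (f := s) (l := atTop) T (tendsto_pi_nhds.2 hs), hs⟩

/-! ### Positivity and normality of the trace -/

section Trace

variable {M : VonNeumannAlgebra H} (τ : FiniteTrace M)

/-- The square root of a positive element, as an element of the algebra. -/
theorem exists_sqrt {x : El M} (hx : 0 ≤ (x : H →L[ℂ] H)) :
    ∃ r : El M, star r = r ∧ r * r = x :=
  ⟨⟨CFC.sqrt (x : H →L[ℂ] H), sqrt_mem M x.2⟩,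
    Subtype.ext (CFC.sqrt_nonneg (x : H →L[ℂ] H)).isSelfAdjoint.star_eq,
    Subtype.ext (CFC.sqrt_mul_sqrt_self _ hx)⟩

theorem trace_mul_nonneg {x y : El M} (hx : 0 ≤ (x : H →L[ℂ] H)) (hy : 0 ≤ (y : H →L[ℂ] H)) :
    0 ≤ τ.toLin (x * y) := by
  obtain ⟨r, hr, rfl⟩ := exists_sqrt hy
  rw [← mul_assoc, τ.tracial, ← mul_assoc]
  refine τ.nonneg _ ?_
  have := star_left_conjugate_nonneg hx (r : H →L[ℂ] H)
  rw [show star (r : H →L[ℂ] H) = r from congrArg Subtype.val hr] at this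
  exact this

theorem trace_re_nonneg {x : El M} (hx : 0 ≤ (x : H →L[ℂ] H)) : 0 ≤ (τ.toLin x).re :=
  (Complex.le_def.1 (τ.nonneg x hx)).1

theorem trace_re_mono {x y : El M} (h : (x : H →L[ℂ] H) ≤ y) :
    (τ.toLin x).re ≤ (τ.toLin y).re := by
  have := trace_re_nonneg τ (x := y - x) (sub_nonneg.2 h)
  rw [map_sub, Complex.sub_re] at this
  linarith

/-- Hölder's inequality `|τ (R y)| ≤ ‖y‖ ‖R‖₁` for positive `R`. -/
theorem norm_trace_mul_le {R : El M} (hR : 0 ≤ (R : H →L[ℂ] H)) (y : El M) :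
    ‖τ.toLin (R * y)‖ ≤ ‖(y : H →L[ℂ] H)‖ * (τ.toLin R).re := by
  obtain ⟨r, hr, rfl⟩ := exists_sqrt hR
  have h1 : τ.toLin (r * r * y) = ⟪toPre τ r, toPre τ (r * y)⟫_ℂ := by
    rw [inner_def]
    change _ = τ.toLin (star r * (r * y))
    rw [hr, mul_assoc]
  have h2 : (τ.toLin (r * r)).re = ‖toPre τ r‖ ^ 2 := by
    rw [norm_sq_def]
    change _ = (τ.toLin (star r * r)).re
    rw [hr]
  rw [h1, h2]
  calc _ ≤ ‖toPre τ r‖ * ‖toPre τ (r * y)‖ := norm_inner_le_norm _ _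
    _ ≤ ‖toPre τ r‖ * (‖(y : H →L[ℂ] H)‖ * ‖toPre τ r‖) := by
      gcongr
      exact pre_norm_mul_le τ r y
    _ = _ := by ring

/-- A self-adjoint element `h` of `V` with `τ (h y) ≥ 0` for all `y ≥ 0` in `V` is positive: its
negative part lies in `V` and `τ (h h⁻) = - τ ((h⁻)²)`. -/
theorem nonneg_of_trace_mul_nonneg {V : VonNeumannAlgebra H} (hV : V ≤ M) {h : El M}
    (hh : (h : H →L[ℂ] H) ∈ V) (hsa : IsSelfAdjoint (h : H →L[ℂ] H))
    (hpos : ∀ y : El M, (y : H →L[ℂ] H) ∈ V → 0 ≤ (y : H →L[ℂ] H) → 0 ≤ (τ.toLin (h * y)).re) :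
    0 ≤ (h : H →L[ℂ] H) := by
  have hmem : (h : H →L[ℂ] H)⁻ ∈ V := negPart_mem V hh
  set w : El M := ⟨(h : H →L[ℂ] H)⁻, hV hmem⟩ with hw
  have hw0 : 0 ≤ (w : H →L[ℂ] H) := CFC.negPart_nonneg _
  have hwsa : star w = w := Subtype.ext hw0.isSelfAdjoint.star_eq
  have hprod : h * w = -(star w * w) := by
    rw [hwsa]
    apply Subtype.ext
    change (h : H →L[ℂ] H) * (h : H →L[ℂ] H)⁻ = -((h : H →L[ℂ] H)⁻ * (h : H →L[ℂ] H)⁻)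
    calc (h : H →L[ℂ] H) * (h : H →L[ℂ] H)⁻
        = ((h : H →L[ℂ] H)⁺ - (h : H →L[ℂ] H)⁻) * (h : H →L[ℂ] H)⁻ := by
          rw [CFC.posPart_sub_negPart (h : H →L[ℂ] H) hsa]
      _ = _ := by rw [sub_mul, CFC.posPart_mul_negPart, zero_sub]
  have h1 := hpos w hmem hw0
  rw [hprod, map_neg, Complex.neg_re] at h1
  have h2 := norm_sq_def τ (toPre τ w)
  change _ = (τ.toLin (star w * w)).re at h2
  have h3 : toPre τ w = 0 := by
    rw [← norm_eq_zero, ← sq_eq_zero_iff]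
    exact le_antisymm (by linarith) (sq_nonneg _)
  have h4 : w = 0 := (toPre τ).injective (by rw [h3, map_zero])
  exact (CFC.negPart_eq_zero_iff _ hsa).1 (congrArg Subtype.val h4)

/-- If `τ (b y) ≤ τ (m y)` for all `y ≥ 0` in `V`, with `b = b*` in `V`, then `b ≤ ‖m‖ 1`. -/
theorem le_norm_smul_one_of_trace_mul_le {V : VonNeumannAlgebra H} (hV : V ≤ M) {b m : El M}
    (hb : (b : H →L[ℂ] H) ∈ V) (hsa : IsSelfAdjoint (b : H →L[ℂ] H))
    (h : ∀ y : El M, (y : H →L[ℂ] H) ∈ V → 0 ≤ (y : H →L[ℂ] H) →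
      (τ.toLin (b * y)).re ≤ (τ.toLin (m * y)).re) :
    (b : H →L[ℂ] H) ≤ ‖(m : H →L[ℂ] H)‖ • 1 := by
  set c : ℝ := ‖(m : H →L[ℂ] H)‖ with hc
  have hcoe : (((c : ℂ) • (1 : El M) - b : El M) : H →L[ℂ] H) = c • 1 - (b : H →L[ℂ] H) := by
    simp [← Complex.coe_smul]
  rw [← sub_nonneg, ← hcoe]
  refine nonneg_of_trace_mul_nonneg τ hV ?_ ?_ fun y hy hy0 => ?_
  · exact sub_mem (V.toStarSubalgebra.smul_mem (one_mem V) _) hb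
  · rw [hcoe]
    exact ((IsSelfAdjoint.all c).smul (.one _)).sub hsa
  · have h1 := norm_trace_mul_le τ hy0 m
    rw [τ.tracial] at h1
    have h2 := h y hy hy0
    rw [sub_mul, map_sub, smul_mul_assoc, one_mul, map_smul, smul_eq_mul, Complex.sub_re,
      Complex.re_ofReal_mul]
    linarith [(Complex.re_le_norm (τ.toLin (m * y)))]

/-- Normality of `τ` along an increasing sequence `S K` of positive elements with strong limit `s`:
`τ (S K y) → τ (s y)`, since `|τ ((s - S K) y)| ≤ ‖y‖ τ (s - S K)`. -/
theorem tendsto_trace_mul {S : ℕ → El M} {s : El M}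
    (hmono : Monotone fun K => (S K : H →L[ℂ] H)) (h0 : ∀ K, 0 ≤ (S K : H →L[ℂ] H))
    (hs : ∀ ξ, Tendsto (fun K => (S K : H →L[ℂ] H) ξ) atTop (𝓝 ((s : H →L[ℂ] H) ξ))) (y : El M) :
    Tendsto (fun K => τ.toLin (S K * y)) atTop (𝓝 (τ.toLin (s * y))) := by
  have hle := le_of_strong_tendsto hmono hs
  have hlub : IsLUB ((fun x : El M => (x : H →L[ℂ] H)) '' Set.range S) (s : H →L[ℂ] H) := by
    refine ⟨?_, fun t ht => strong_tendsto_le (fun K => ht ⟨S K, ⟨K, rfl⟩, rfl⟩) hs⟩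
    rintro _ ⟨_, ⟨K, rfl⟩, rfl⟩
    exact hle K
  have h1 := τ.normal (Set.range S) (Set.range_nonempty S) (by rintro _ ⟨K, rfl⟩; exact h0 K)
    (by
      rintro _ ⟨J, rfl⟩ _ ⟨K, rfl⟩
      exact ⟨S (max J K), ⟨_, rfl⟩, hmono (le_max_left _ _), hmono (le_max_right _ _)⟩) s hlub
  rw [← Set.range_comp] at h1
  have h2 : Tendsto (fun K => (τ.toLin (S K)).re) atTop (𝓝 (τ.toLin s).re) :=
    tendsto_atTop_isLUB (fun J K hJK => trace_re_mono τ (hmono hJK)) h1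
  have h3 : Tendsto (fun K => ‖(y : H →L[ℂ] H)‖ * ((τ.toLin s).re - (τ.toLin (S K)).re)) atTop
      (𝓝 0) := by
    simpa using (h2.const_sub (τ.toLin s).re).const_mul ‖(y : H →L[ℂ] H)‖
  rw [tendsto_iff_norm_sub_tendsto_zero]
  refine squeeze_zero (fun _ => norm_nonneg _) (fun K => ?_) h3
  have := norm_trace_mul_le τ (R := s - S K) (sub_nonneg.2 (hle K)) y
  rwa [sub_mul, map_sub, map_sub, Complex.sub_re, norm_sub_rev] at this

end Trace

/-! ### Generated von Neumann algebras and conditional expectations -/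

theorem subset_vnGen (S : Set (H →L[ℂ] H)) : S ⊆ (vnGen S : Set (H →L[ℂ] H)) := by
  intro x hx
  change x ∈ StarSubalgebra.centralizer ℂ (StarSubalgebra.centralizer ℂ S : Set (H →L[ℂ] H))
  rw [StarSubalgebra.mem_centralizer_iff]
  intro g hg
  have h2 : star g ∈ (StarSubalgebra.centralizer ℂ S : Set (H →L[ℂ] H)) := star_mem hg
  exact ⟨((StarSubalgebra.mem_centralizer_iff ℂ).1 hg x hx).1.symm,
    ((StarSubalgebra.mem_centralizer_iff ℂ).1 h2 x hx).1.symm⟩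

theorem vnGen_le {S : Set (H →L[ℂ] H)} {V : VonNeumannAlgebra H} (h : S ⊆ V) : vnGen S ≤ V := by
  intro x hx
  change x ∈ StarSubalgebra.centralizer ℂ (StarSubalgebra.centralizer ℂ S : Set (H →L[ℂ] H)) at hx
  refine mem_of_forall_commute V fun g hg => ?_
  rw [StarSubalgebra.mem_centralizer_iff] at hx
  refine (hx g ?_).1
  refine (StarSubalgebra.mem_centralizer_iff ℂ).2 fun s hs => ?_
  exact ⟨commute_of_mem V (h hs) hg, commute_of_mem V (star_mem (h hs)) hg⟩

theorem le_genFiltration (A : ℕ → VonNeumannAlgebra H) {k n : ℕ} (hk : k ≤ n) :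
    A k ≤ genFiltration A n :=
  fun _ hx => subset_vnGen _ (Set.mem_biUnion (Set.mem_Iic.2 hk) hx)

theorem genFiltration_le {A : ℕ → VonNeumannAlgebra H} {n : ℕ} {V : VonNeumannAlgebra H}
    (h : ∀ k ≤ n, A k ≤ V) : genFiltration A n ≤ V :=
  vnGen_le (Set.iUnion₂_subset h)

theorem genFiltration_mono (A : ℕ → VonNeumannAlgebra H) : Monotone (genFiltration A) :=
  fun _ _ hmn => genFiltration_le fun _ hk => le_genFiltration A (hk.trans hmn)

section CondExp

variable {M N : VonNeumannAlgebra H} {τ : FiniteTrace M} {E : El M →ₗ[ℂ] El M}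

theorem IsTraceCondExp.trace_map_mul (hE : IsTraceCondExp τ N E) (x : El M) {y : El M}
    (hy : (y : H →L[ℂ] H) ∈ N) : τ.toLin (E x * y) = τ.toLin (x * y) := by
  have h := hE.bimodule 1 x y (one_mem N) hy
  rw [one_mul, one_mul] at h
  rw [← h, hE.trace_preserving]

theorem IsTraceCondExp.trace_mul_map (hE : IsTraceCondExp τ N E) (x : El M) {y : El M}
    (hy : (y : H →L[ℂ] H) ∈ N) : τ.toLin (y * E x) = τ.toLin (y * x) := by
  rw [τ.tracial, hE.trace_map_mul x hy, τ.tracial]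

theorem IsTraceCondExp.mono (hE : IsTraceCondExp τ N E) {x y : El M}
    (h : (x : H →L[ℂ] H) ≤ y) : (E x : H →L[ℂ] H) ≤ E y := by
  have := hE.nonneg (y - x) (sub_nonneg.2 h)
  rw [map_sub] at this
  exact sub_nonneg.1 this

theorem IsTraceCondExp.le_smul_one (hE : IsTraceCondExp τ N E) {x : El M} {c : ℝ}
    (h : (x : H →L[ℂ] H) ≤ c • 1) : (E x : H →L[ℂ] H) ≤ c • 1 := by
  have hcoe : (((c : ℂ) • (1 : El M) : El M) : H →L[ℂ] H) = c • 1 := by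
    simp [← Complex.coe_smul]
  have h1 := hE.mono (x := x) (y := (c : ℂ) • 1) (h.trans_eq hcoe.symm)
  rwa [map_smul, hE.id_of_mem 1 (one_mem N), hcoe] at h1

theorem IsTraceCondExp.map_map (hE : IsTraceCondExp τ N E) (x : El M) : E (E x) = E x :=
  hE.id_of_mem _ (hE.mem x)

/-- The kernel of `E` is self-adjoint: if `E x = 0` then `w = E (x*)` satisfies
`τ (w* w) = τ (w* x*) = conj (τ (x w)) = conj (τ (E x w)) = 0`. -/
theorem IsTraceCondExp.map_star_eq_zero (hE : IsTraceCondExp τ N E) {x : El M} (hx : E x = 0) :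
    E (star x) = 0 := by
  set w := E (star x) with hw
  have hwN : (w : H →L[ℂ] H) ∈ N := hE.mem _
  have hwN' : ((star w : El M) : H →L[ℂ] H) ∈ N := star_mem hwN
  have h1 : τ.toLin (star w * w) = 0 := by
    rw [hw, hE.trace_mul_map _ hwN', ← star_mul, τ.map_star, ← hE.trace_map_mul _ hwN, hx]
    simp
  have h2 := norm_sq_def τ (toPre τ w)
  change _ = (τ.toLin (star w * w)).re at h2
  rw [h1, Complex.zero_re, sq_eq_zero_iff, norm_eq_zero] at h2
  exact (toPre τ).injective (by rw [h2, map_zero])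

end CondExp

/-! ### Centered order-independent sequences -/

/-- The sequence `a` is centered for the conditional expectation `E` onto `N` and adapted to the
order-independent algebras `A n`, the first of which contains `N`. -/
structure IsCenteredIndep {M : VonNeumannAlgebra H} (τ : FiniteTrace M) (N : VonNeumannAlgebra H)
    (E : El M →ₗ[ℂ] El M) (A : ℕ → VonNeumannAlgebra H) (a : ℕ → El M) : Prop where
  condExp : IsTraceCondExp τ N E
  indep : IsOrderIndependent E A
  le_zero : N ≤ A 0
  mem : ∀ n, (a n : H →L[ℂ] H) ∈ A n
  map_eq_zero : ∀ n, E (a n) = 0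

/-- The partial sum `|a n|² + ∑_{n < k < K} E |a k|²` of the series for `E_n |∑_{k ≥ n} a k|²`. -/
noncomputable def colSquare {M : VonNeumannAlgebra H} (E : El M →ₗ[ℂ] El M) (a : ℕ → El M)
    (n K : ℕ) : El M :=
  star (a n) * a n + ∑ k ∈ Finset.Ico (n + 1) K, E (star (a k) * a k)

theorem coe_sum {M : VonNeumannAlgebra H} (s : Finset ℕ) (f : ℕ → El M) :
    ((∑ k ∈ s, f k : El M) : H →L[ℂ] H) = ∑ k ∈ s, (f k : H →L[ℂ] H) :=
  map_sum M.toStarSubalgebra.subtype f s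

theorem toL2_mem_L2Sub {M : VonNeumannAlgebra H} (τ : FiniteTrace M) {V : VonNeumannAlgebra H}
    {x : El M} (hx : (x : H →L[ℂ] H) ∈ V) :
    toL2 τ x ∈ L2Sub τ V :=
  Submodule.le_topologicalClosure _ (Submodule.mem_map_of_mem hx)

namespace IsCenteredIndep

variable {M N : VonNeumannAlgebra H} {τ : FiniteTrace M} {E : El M →ₗ[ℂ] El M}
  {A : ℕ → VonNeumannAlgebra H} {a : ℕ → El M} (h : IsCenteredIndep τ N E A a)

include h

theorem adjoint : IsCenteredIndep τ N E A fun n => star (a n) where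
  condExp := h.condExp
  indep := h.indep
  le_zero := h.le_zero
  mem n := star_mem (h.mem n)
  map_eq_zero n := h.condExp.map_star_eq_zero (h.map_eq_zero n)

theorem filtration_le (n : ℕ) : genFiltration A n ≤ M := genFiltration_le fun k _ => h.indep.le k

theorem le_filtration (n : ℕ) : N ≤ genFiltration A n :=
  h.le_zero.trans (le_genFiltration A n.zero_le)

theorem mem_filtration {k n : ℕ} (hk : k ≤ n) : (a k : H →L[ℂ] H) ∈ genFiltration A n :=
  le_genFiltration A hk (h.mem k)

theorem map_mul {m n : ℕ} (hmn : m < n) {x b : El M} (hx : (x : H →L[ℂ] H) ∈ A n)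
    (hb : (b : H →L[ℂ] H) ∈ genFiltration A m) : E (x * b) = E x * E b := by
  refine h.indep.map_mul n x b hx ?_
  refine vnGen_le (fun z hz => ?_) hb
  obtain ⟨k, hk, hz⟩ := Set.mem_iUnion₂.1 hz
  exact subset_vnGen _ (Set.mem_biUnion (Set.mem_Iio.2 ((Set.mem_Iic.1 hk).trans_lt hmn)) hz)

theorem trace_mul_eq_zero {m n : ℕ} (hmn : m < n) {b : El M}
    (hb : (b : H →L[ℂ] H) ∈ genFiltration A m) : τ.toLin (a n * b) = 0 := by
  rw [← h.condExp.trace_preserving, h.map_mul hmn (h.mem n) hb, h.map_eq_zero]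
  simp

theorem trace_map_mul {m n : ℕ} (hmn : m < n) {x b : El M} (hx : (x : H →L[ℂ] H) ∈ A n)
    (hb : (b : H →L[ℂ] H) ∈ genFiltration A m) : τ.toLin (E x * b) = τ.toLin (x * b) := by
  rw [← h.condExp.trace_preserving (x * b), h.map_mul hmn hx hb,
    h.condExp.trace_mul_map _ (h.condExp.mem x)]

theorem star_mul_self_mem (n : ℕ) : ((star (a n) * a n : El M) : H →L[ℂ] H) ∈ A n :=
  mul_mem (S := VonNeumannAlgebra H) (star_mem (h.mem n)) (h.mem n)

theorem sum_mem (n : ℕ) {s : Finset ℕ} (hs : ∀ k ∈ s, k ≤ n) :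
    ((∑ k ∈ s, a k : El M) : H →L[ℂ] H) ∈ genFiltration A n := by
  rw [coe_sum]
  exact _root_.sum_mem fun k hk => h.mem_filtration (hs k hk)

theorem colSquare_mem (n K : ℕ) : (colSquare E a n K : H →L[ℂ] H) ∈ genFiltration A n := by
  refine add_mem (S := VonNeumannAlgebra H)
    (le_genFiltration A le_rfl (h.star_mul_self_mem n)) ?_
  change ((∑ k ∈ Finset.Ico (n + 1) K, E (star (a k) * a k) : El M) : H →L[ℂ] H) ∈ _
  rw [coe_sum]
  exact _root_.sum_mem fun k _ => h.le_filtration n (h.condExp.mem _)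

theorem map_star_mul_self_nonneg (n : ℕ) : 0 ≤ (E (star (a n) * a n) : H →L[ℂ] H) :=
  h.condExp.nonneg _ (star_mul_self_nonneg' _)

theorem colSquare_nonneg (n K : ℕ) : 0 ≤ (colSquare E a n K : H →L[ℂ] H) := by
  refine add_nonneg (star_mul_self_nonneg' _) ?_
  change 0 ≤ ((∑ k ∈ Finset.Ico (n + 1) K, E (star (a k) * a k) : El M) : H →L[ℂ] H)
  rw [coe_sum]
  exact Finset.sum_nonneg fun k _ => h.map_star_mul_self_nonneg k

theorem colSquare_mono (n : ℕ) : Monotone fun K => (colSquare E a n K : H →L[ℂ] H) := by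
  intro J K hJK
  refine add_le_add le_rfl ?_
  change ((∑ k ∈ Finset.Ico (n + 1) J, E (star (a k) * a k) : El M) : H →L[ℂ] H) ≤
    ((∑ k ∈ Finset.Ico (n + 1) K, E (star (a k) * a k) : El M) : H →L[ℂ] H)
  rw [coe_sum, coe_sum]
  exact Finset.sum_le_sum_of_subset_of_nonneg (Finset.Ico_subset_Ico le_rfl hJK)
    fun k _ _ => h.map_star_mul_self_nonneg k

/-- In `τ (|∑_{n ≤ k < K} a k|² y)` the mixed terms vanish for `y ∈ F n`, and `|a k|²` may be
replaced by `E |a k|²` for `k > n`. -/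
theorem trace_sq_mul {n K : ℕ} (hK : n < K) {y : El M}
    (hy : (y : H →L[ℂ] H) ∈ genFiltration A n) :
    τ.toLin (star (∑ k ∈ Finset.Ico n K, a k) * (∑ k ∈ Finset.Ico n K, a k) * y) =
      τ.toLin (colSquare E a n K * y) := by
  obtain ⟨d, rfl⟩ := Nat.exists_eq_add_of_le (Nat.succ_le_of_lt hK)
  clear hK
  induction d with
  | zero => simp [colSquare]
  | succ d ih =>
    set P := ∑ k ∈ Finset.Ico n (n + 1 + d), a k with hP
    have hPmem : (P : H →L[ℂ] H) ∈ genFiltration A (n + d) :=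
      h.sum_mem _ fun k hk => by have := (Finset.mem_Ico.1 hk).2; omega
    have hy' : (y : H →L[ℂ] H) ∈ genFiltration A (n + d) :=
      genFiltration_mono A (Nat.le_add_right n d) hy
    have hlt : n + d < n + 1 + d := by omega
    have e1 : τ.toLin (star P * a (n + 1 + d) * y) = 0 := by
      rw [mul_assoc, τ.tracial, mul_assoc]
      exact h.trace_mul_eq_zero hlt (mul_mem (S := VonNeumannAlgebra H) hy' (star_mem hPmem))
    have e2 : τ.toLin (star (a (n + 1 + d)) * P * y) = 0 := by
      rw [mul_assoc]
      exact h.adjoint.trace_mul_eq_zero hlt (mul_mem (S := VonNeumannAlgebra H) hPmem hy')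
    have e3 : τ.toLin (star (a (n + 1 + d)) * a (n + 1 + d) * y) =
        τ.toLin (E (star (a (n + 1 + d)) * a (n + 1 + d)) * y) :=
      (h.trace_map_mul hlt (h.star_mul_self_mem _) hy').symm
    have hcol : colSquare E a n (n + 1 + (d + 1)) = colSquare E a n (n + 1 + d) +
        E (star (a (n + 1 + d)) * a (n + 1 + d)) := by
      rw [colSquare, colSquare, ← add_assoc (n + 1) d 1, Finset.sum_Ico_succ_top (by omega),
        ← add_assoc (star (a n) * a n)]
    rw [hcol, add_mul, map_add, ← ih, ← e3, ← add_assoc (n + 1) d 1,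
      Finset.sum_Ico_succ_top (by omega), ← hP, star_add, add_mul, mul_add, mul_add, add_mul,
      add_mul, add_mul, map_add, map_add, map_add, e1, e2]
    ring

/-! ### The martingale in `L²` -/

theorem toL2_mem_orthogonal {m n : ℕ} (hmn : m < n) :
    toL2 τ (a n) ∈ (L2Sub τ (genFiltration A m))ᗮ := by
  rw [L2Sub, Submodule.orthogonal_closure, Submodule.mem_orthogonal]
  rintro _ ⟨y, hy, rfl⟩
  have hy' : (y : H →L[ℂ] H) ∈ genFiltration A m := hy
  have : ⟪toL2 τ y, toL2 τ (a n)⟫_ℂ = τ.toLin (star y * a n) :=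
    UniformSpace.Completion.inner_coe _ _
  rw [this, τ.tracial]
  exact h.trace_mul_eq_zero hmn (star_mem hy')

theorem sub_prevCondExp_sum {n K : ℕ} (hK : n ≤ K) :
    (∑ k ∈ Finset.range K, toL2 τ (a k)) -
        prevCondExp τ (genFiltration A) n (∑ k ∈ Finset.range K, toL2 τ (a k)) =
      toL2 τ (∑ k ∈ Finset.Ico n K, a k) := by
  rw [map_sum (toL2 τ)]
  cases n with
  | zero => simp [prevCondExp]
  | succ m =>
    have key : prevCondExp τ (genFiltration A) (m + 1) (∑ k ∈ Finset.range K, toL2 τ (a k)) =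
        ∑ k ∈ Finset.range (m + 1), toL2 τ (a k) := by
      refine Submodule.eq_starProjection_of_mem_orthogonal' (K := L2Sub τ (genFiltration A m))
        (z := ∑ k ∈ Finset.Ico (m + 1) K, toL2 τ (a k)) ?_ ?_ ?_
      · exact _root_.sum_mem fun k hk =>
          toL2_mem_L2Sub τ (h.mem_filtration (Nat.lt_succ_iff.1 (Finset.mem_range.1 hk)))
      · exact _root_.sum_mem fun k hk =>
          h.toL2_mem_orthogonal (Nat.succ_le_iff.1 (Finset.mem_Ico.1 hk).1)
      · exact (Finset.sum_range_add_sum_Ico _ hK).symm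
    rw [key, ← Finset.sum_range_add_sum_Ico _ hK]
    simp

/-- The identity `E_n |x - E_{n-1} x|² = |a n|² + ∑_{k > n} E |a k|²` for `x = ∑ a k`, in weak
form. -/
theorem tendsto_trace_colSquare {x : L2 τ}
    (hx : Tendsto (fun K => ∑ k ∈ Finset.range K, toL2 τ (a k)) atTop (𝓝 x)) (n : ℕ) {y : El M}
    (hy : (y : H →L[ℂ] H) ∈ genFiltration A n) :
    Tendsto (fun K => τ.toLin (colSquare E a n K * y)) atTop
      (𝓝 (traceSqAbs τ (x - prevCondExp τ (genFiltration A) n x) y)) := by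
  have hcont : Continuous fun z : L2 τ =>
      traceSqAbs τ (z - prevCondExp τ (genFiltration A) n z) y := by
    unfold traceSqAbs
    fun_prop
  refine ((hcont.tendsto x).comp hx).congr' ?_
  filter_upwards [eventually_gt_atTop n] with K hK
  rw [Function.comp_apply, h.sub_prevCondExp_sum hK.le, traceSqAbs_toL2, h.trace_sq_mul hK hy]

theorem norm_sq_toL2_sum (J K : ℕ) :
    ‖toL2 τ (∑ k ∈ Finset.Ico J K, a k)‖ ^ 2 =
      ∑ k ∈ Finset.Ico J K, (τ.toLin (E (star (a k) * a k))).re := by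
  rcases le_or_gt K J with hKJ | hJK
  · simp [Finset.Ico_eq_empty_of_le hKJ]
  have h1 := h.trace_sq_mul (y := 1) hJK (one_mem _)
  rw [mul_one, mul_one] at h1
  have h2 : ‖toL2 τ (∑ k ∈ Finset.Ico J K, a k)‖ = ‖toPre τ (∑ k ∈ Finset.Ico J K, a k)‖ :=
    UniformSpace.Completion.norm_coe _
  rw [h2, norm_sq_def]
  change (τ.toLin (star (∑ k ∈ Finset.Ico J K, a k) * (∑ k ∈ Finset.Ico J K, a k))).re = _
  rw [h1, colSquare, map_add, map_sum, ← h.condExp.trace_preserving (star (a J) * a J),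
    ← Finset.sum_eq_sum_Ico_succ_bot hJK fun k => τ.toLin (E (star (a k) * a k)),
    Complex.re_sum]

theorem exists_tendsto_of_sum_le {c : ℝ}
    (hc : ∀ K, ((∑ k ∈ Finset.range K, E (star (a k) * a k) : El M) : H →L[ℂ] H) ≤ c • 1) :
    ∃ x : L2 τ, Tendsto (fun K => ∑ k ∈ Finset.range K, toL2 τ (a k)) atTop (𝓝 x) := by
  set f : ℕ → ℝ := fun k => (τ.toLin (E (star (a k) * a k))).re with hf
  have hf0 : ∀ k, 0 ≤ f k := fun k => trace_re_nonneg τ (h.map_star_mul_self_nonneg k)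
  have hcoe : (((c : ℂ) • (1 : El M) : El M) : H →L[ℂ] H) = c • 1 := by
    simp [← Complex.coe_smul]
  have hsum : Summable f := by
    refine summable_of_sum_range_le (c := (τ.toLin ((c : ℂ) • 1)).re) hf0 fun K => ?_
    have := trace_re_mono τ ((hc K).trans_eq hcoe.symm)
    rwa [map_sum, Complex.re_sum] at this
  have hcau := hsum.hasSum.tendsto_sum_nat.cauchySeq
  refine cauchySeq_tendsto_of_complete (Metric.cauchySeq_iff'.2 fun ε hε => ?_)
  obtain ⟨J, hJ⟩ := Metric.cauchySeq_iff'.1 hcau (ε ^ 2) (by positivity)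
  refine ⟨J, fun K hK => ?_⟩
  have h1 := hJ K hK
  rw [Real.dist_eq, ← Finset.sum_Ico_eq_sub _ hK] at h1
  rw [dist_eq_norm, ← Finset.sum_Ico_eq_sub _ hK, ← map_sum, ← sq_lt_sq₀ (norm_nonneg _) hε.le,
    h.norm_sq_toL2_sum]
  exact (le_abs_self _).trans_lt h1

/-! ### The conditional square function and its norm -/

theorem enorm_colSquare_le {x : L2 τ}
    (hx : Tendsto (fun K => ∑ k ∈ Finset.range K, toL2 τ (a k)) atTop (𝓝 x)) (n K : ℕ) :
    ‖(colSquare E a n K : H →L[ℂ] H)‖ₑ ≤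
      condExpSqNorm τ (genFiltration A n) (x - prevCondExp τ (genFiltration A) n x) := by
  refine le_iInf₂ fun m hm => ?_
  rw [enorm_le_iff_norm_le]
  refine norm_le_of_le_smul_one (norm_nonneg _) (h.colSquare_nonneg n K) ?_
  refine le_norm_smul_one_of_trace_mul_le τ (h.filtration_le n) (h.colSquare_mem n K)
    (h.colSquare_nonneg n K).isSelfAdjoint fun y hy hy0 => ?_
  rw [hm.2 y hy]
  -- The traces increase with the number of terms, since `y ≥ 0`.
  refine ge_of_tendsto ((Complex.continuous_re.tendsto _).comp
    (h.tendsto_trace_colSquare hx n hy)) ?_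
  filter_upwards [eventually_ge_atTop K] with L hL
  have h1 := trace_mul_nonneg τ (x := colSquare E a n L - colSquare E a n K)
    (sub_nonneg.2 (h.colSquare_mono n hL)) hy0
  rw [sub_mul, map_sub] at h1
  have h2 := (Complex.le_def.1 h1).1
  simpa using h2

theorem condExpSqNorm_le {x : L2 τ}
    (hx : Tendsto (fun K => ∑ k ∈ Finset.range K, toL2 τ (a k)) atTop (𝓝 x)) (n : ℕ) {B c : ℝ}
    (hB : ‖(a n : H →L[ℂ] H)‖ ≤ B) (hc0 : 0 ≤ c)
    (hc : ∀ K, ((∑ k ∈ Finset.range K, E (star (a k) * a k) : El M) : H →L[ℂ] H) ≤ c • 1) :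
    condExpSqNorm τ (genFiltration A n) (x - prevCondExp τ (genFiltration A) n x) ≤
      ENNReal.ofReal (B ^ 2 + c) := by
  have hbd : ∀ K, (colSquare E a n K : H →L[ℂ] H) ≤ (B ^ 2 + c) • 1 := fun K => by
    rw [add_smul]
    refine add_le_add ?_ ((?_ : _ ≤ _).trans (hc K))
    · refine le_smul_one_of_norm_le (star_mul_self_nonneg' (a n)).isSelfAdjoint ?_
      change ‖star (a n : H →L[ℂ] H) * (a n : H →L[ℂ] H)‖ ≤ _
      rw [CStarRing.norm_star_mul_self, ← sq]
      gcongr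
    · change ((∑ k ∈ Finset.Ico (n + 1) K, E (star (a k) * a k) : El M) : H →L[ℂ] H) ≤ _
      rw [coe_sum, coe_sum, Finset.range_eq_Ico]
      exact Finset.sum_le_sum_of_subset_of_nonneg (Finset.Ico_subset_Ico (Nat.zero_le _) le_rfl)
        fun k _ _ => h.map_star_mul_self_nonneg k
  obtain ⟨s, hs⟩ := exists_strong_tendsto (h.colSquare_mono n) (h.colSquare_nonneg n) hbd
  have hsmem : s ∈ genFiltration A n := mem_of_strong_tendsto _ (h.colSquare_mem n) hs
  have hs0 : 0 ≤ s := nonneg_of_strong_tendsto (Eventually.of_forall (h.colSquare_nonneg n)) hs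
  have hle : condExpSqNorm τ (genFiltration A n) (x - prevCondExp τ (genFiltration A) n x) ≤
      ‖s‖ₑ :=
    iInf₂_le (⟨s, h.filtration_le n hsmem⟩ : El M) ⟨hsmem, fun y hy => tendsto_nhds_unique
      (tendsto_trace_mul τ (s := ⟨s, h.filtration_le n hsmem⟩) (h.colSquare_mono n)
        (h.colSquare_nonneg n) hs y)
      (h.tendsto_trace_colSquare hx n hy)⟩
  refine hle.trans ?_
  rw [← ofReal_norm]
  exact ENNReal.ofReal_le_ofReal
    (norm_le_of_le_smul_one (by positivity) hs0 (strong_tendsto_le hbd hs))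

end IsCenteredIndep

/-! ### The norm of the square root of a sum -/

theorem sqrtSumNorm_eq {b : ℕ → H →L[ℂ] H} {s : H →L[ℂ] H}
    (hs : ∀ ξ, Tendsto (fun K => ∑ n ∈ Finset.range K, b n ξ) atTop (𝓝 (s ξ))) :
    sqrtSumNorm b = ‖CFC.sqrt s‖ₑ := by
  refine le_antisymm (iInf₂_le s hs) (le_iInf₂ fun t ht => ?_)
  rw [show s = t from ContinuousLinearMap.ext fun ξ => tendsto_nhds_unique (hs ξ) (ht ξ)]

theorem monotone_sum_range {b : ℕ → H →L[ℂ] H} (hb : ∀ n, 0 ≤ b n) :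
    Monotone fun K => ∑ n ∈ Finset.range K, b n :=
  fun _ _ hJK => Finset.sum_le_sum_of_subset_of_nonneg (Finset.range_mono hJK) fun n _ _ => hb n

theorem sqrtSumNorm_le {b : ℕ → H →L[ℂ] H} (hb : ∀ n, 0 ≤ b n) {c : ℝ} (hc0 : 0 ≤ c)
    (hc : ∀ K, ∑ n ∈ Finset.range K, b n ≤ (c ^ 2) • 1) : sqrtSumNorm b ≤ ENNReal.ofReal c := by
  have hb' : ∀ K, 0 ≤ ∑ n ∈ Finset.range K, b n := fun K => Finset.sum_nonneg fun n _ => hb n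
  obtain ⟨s, hs⟩ := exists_strong_tendsto (monotone_sum_range hb) hb' hc
  have hs0 : 0 ≤ s := nonneg_of_strong_tendsto (Eventually.of_forall hb') hs
  rw [sqrtSumNorm_eq (strong_tendsto_sum_iff.2 hs), ← ofReal_norm]
  refine ENNReal.ofReal_le_ofReal ?_
  rw [← sq_le_sq₀ (norm_nonneg _) hc0, norm_sqrt_sq hs0]
  exact norm_le_of_le_smul_one (by positivity) hs0 (strong_tendsto_le hc hs)

theorem exists_sum_le_of_sqrtSumNorm_ne_top {b : ℕ → H →L[ℂ] H} (hb : ∀ n, 0 ≤ b n)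
    (h : sqrtSumNorm b ≠ ⊤) :
    ∃ c : ℝ, 0 ≤ c ∧ sqrtSumNorm b = ENNReal.ofReal c ∧
      ∀ K, ∑ n ∈ Finset.range K, b n ≤ (c ^ 2) • 1 := by
  have hex : ∃ s : H →L[ℂ] H,
      ∀ ξ, Tendsto (fun K => ∑ n ∈ Finset.range K, b n ξ) atTop (𝓝 (s ξ)) := by
    by_contra hne
    push Not at hne
    refine h (top_unique (le_iInf₂ fun s hs => ?_))
    obtain ⟨ξ, hξ⟩ := hne s
    exact absurd (hs ξ) hξ
  obtain ⟨s, hs⟩ := hex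
  have hs' := strong_tendsto_sum_iff.1 hs
  have hs0 : 0 ≤ s := nonneg_of_strong_tendsto
    (Eventually.of_forall fun K => Finset.sum_nonneg fun n _ => hb n) hs'
  refine ⟨‖CFC.sqrt s‖, norm_nonneg _, by rw [sqrtSumNorm_eq hs, ofReal_norm], fun K => ?_⟩
  rw [norm_sqrt_sq hs0]
  exact (le_of_strong_tendsto (monotone_sum_range hb) hs' K).trans
    (le_smul_one_of_norm_le hs0.isSelfAdjoint le_rfl)

/-! ### Comparison of the norms -/

theorem continuous_starL2 {M : VonNeumannAlgebra H} (τ : FiniteTrace M) :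
    Continuous (starL2 τ) :=
  UniformSpace.Completion.continuous_map

theorem rpow_half_le_iff {x y : ℝ≥0∞} : x ^ (1 / 2 : ℝ) ≤ y ↔ x ≤ y ^ 2 := by
  rw [one_div, ENNReal.rpow_inv_le_iff (by norm_num), ENNReal.rpow_two]

theorem tendsto_sum_starL2 {M : VonNeumannAlgebra H} {τ : FiniteTrace M} {a : ℕ → El M}
    {x : L2 τ}
    (hx : Tendsto (fun K => ∑ k ∈ Finset.range K, toL2 τ (a k)) atTop (𝓝 x)) :
    Tendsto (fun K => ∑ k ∈ Finset.range K, toL2 τ (star (a k))) atTop (𝓝 (starL2 τ x)) := by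
  refine (((continuous_starL2 τ).tendsto x).comp hx).congr fun K => ?_
  rw [Function.comp_apply, ← map_sum, starL2_toL2, star_sum, map_sum]

theorem sum_map_add {M : VonNeumannAlgebra H} (E : El M →ₗ[ℂ] El M) (a : ℕ → El M) (K : ℕ) :
    ∑ n ∈ Finset.range K, (E (a n * star (a n) + star (a n) * a n) : H →L[ℂ] H) =
      ((∑ n ∈ Finset.range K, E (star (star (a n)) * star (a n)) : El M) : H →L[ℂ] H) +
        ((∑ n ∈ Finset.range K, E (star (a n) * a n) : El M) : H →L[ℂ] H) := by
  rw [coe_sum, coe_sum, ← Finset.sum_add_distrib]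
  refine Finset.sum_congr rfl fun n _ => ?_
  rw [star_star, map_add]
  rfl

namespace IsCenteredIndep

variable {M N : VonNeumannAlgebra H} {τ : FiniteTrace M} {E : El M →ₗ[ℂ] El M}
  {A : ℕ → VonNeumannAlgebra H} {a : ℕ → El M} (h : IsCenteredIndep τ N E A a)

include h

theorem bmoCol_le {x : L2 τ}
    (hx : Tendsto (fun K => ∑ k ∈ Finset.range K, toL2 τ (a k)) atTop (𝓝 x)) {B c : ℝ}
    (hB0 : 0 ≤ B) (hB : ∀ n, ‖(a n : H →L[ℂ] H)‖ ≤ B) (hc0 : 0 ≤ c)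
    (hc : ∀ K, ((∑ k ∈ Finset.range K, E (star (a k) * a k) : El M) : H →L[ℂ] H) ≤
      (c ^ 2) • 1) :
    bmoCol τ (genFiltration A) x ≤ ENNReal.ofReal (B + c) := by
  refine rpow_half_le_iff.2 (iSup_le fun n => ?_)
  refine (h.condExpSqNorm_le hx n (hB n) (sq_nonneg c) hc).trans ?_
  rw [← ENNReal.ofReal_pow (by positivity)]
  exact ENNReal.ofReal_le_ofReal (by nlinarith [mul_nonneg hB0 hc0])

theorem norm_colSquare_le {x : L2 τ}
    (hx : Tendsto (fun K => ∑ k ∈ Finset.range K, toL2 τ (a k)) atTop (𝓝 x)) {β : ℝ} (hβ0 : 0 ≤ β)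
    (hβ : bmoCol τ (genFiltration A) x ≤ ENNReal.ofReal β) (n K : ℕ) :
    ‖(colSquare E a n K : H →L[ℂ] H)‖ ≤ β ^ 2 := by
  have h1 := rpow_half_le_iff.1 hβ
  have h2 := ((h.enorm_colSquare_le hx n K).trans
    (le_iSup (fun n => condExpSqNorm τ (genFiltration A n)
      (x - prevCondExp τ (genFiltration A) n x)) n)).trans h1
  rwa [← ofReal_norm, ← ENNReal.ofReal_pow hβ0, ENNReal.ofReal_le_ofReal_iff (by positivity)] at h2

theorem norm_le_of_bmoCol_le {x : L2 τ}
    (hx : Tendsto (fun K => ∑ k ∈ Finset.range K, toL2 τ (a k)) atTop (𝓝 x)) {β : ℝ} (hβ0 : 0 ≤ β)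
    (hβ : bmoCol τ (genFiltration A) x ≤ ENNReal.ofReal β) (n : ℕ) :
    ‖(a n : H →L[ℂ] H)‖ ≤ β := by
  have h1 := h.norm_colSquare_le hx hβ0 hβ n 0
  have h2 : (colSquare E a n 0 : H →L[ℂ] H) = star (a n : H →L[ℂ] H) * (a n : H →L[ℂ] H) := by
    simp [colSquare]
  rw [h2, CStarRing.norm_star_mul_self, ← sq] at h1
  exact (sq_le_sq₀ (norm_nonneg _) hβ0).1 h1

theorem sum_le_of_bmoCol_le {x : L2 τ}
    (hx : Tendsto (fun K => ∑ k ∈ Finset.range K, toL2 τ (a k)) atTop (𝓝 x)) {β : ℝ} (hβ0 : 0 ≤ β)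
    (hβ : bmoCol τ (genFiltration A) x ≤ ENNReal.ofReal β) (K : ℕ) :
    ((∑ k ∈ Finset.range K, E (star (a k) * a k) : El M) : H →L[ℂ] H) ≤ (β ^ 2) • 1 := by
  -- `E` maps the first conditional square function to `∑ E |a k|²`.
  have h1 : E (colSquare E a 0 (K + 1)) = ∑ k ∈ Finset.range (K + 1), E (star (a k) * a k) := by
    rw [colSquare, map_add, map_sum, Finset.range_eq_Ico, Finset.sum_eq_sum_Ico_succ_bot
      K.succ_pos]
    simp only [h.condExp.map_map]
  have h2 := h.condExp.le_smul_one (le_smul_one_of_norm_le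
    (h.colSquare_nonneg 0 (K + 1)).isSelfAdjoint (h.norm_colSquare_le hx hβ0 hβ 0 (K + 1)))
  rw [h1] at h2
  refine le_trans ?_ h2
  rw [coe_sum, coe_sum]
  exact monotone_sum_range (b := fun k => (E (star (a k) * a k) : H →L[ℂ] H))
    h.map_star_mul_self_nonneg K.le_succ

theorem map_add_nonneg (n : ℕ) :
    0 ≤ (E (a n * star (a n) + star (a n) * a n) : H →L[ℂ] H) := by
  have := h.adjoint.map_star_mul_self_nonneg n
  rw [star_star] at this
  rw [map_add]
  exact add_nonneg this (h.map_star_mul_self_nonneg n)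

theorem sum_nonneg (K : ℕ) :
    0 ≤ ((∑ n ∈ Finset.range K, E (star (a n) * a n) : El M) : H →L[ℂ] H) := by
  rw [coe_sum]
  exact Finset.sum_nonneg fun k _ => h.map_star_mul_self_nonneg k

theorem bmoOfSeries_le :
    bmoOfSeries τ (genFiltration A) a ≤
      (⨆ n, ‖(a n : H →L[ℂ] H)‖ₑ) +
        sqrtSumNorm (fun n => (E (a n * star (a n) + star (a n) * a n) : H →L[ℂ] H)) := by
  by_cases hBtop : (⨆ n, ‖(a n : H →L[ℂ] H)‖ₑ) = ⊤
  · simp [hBtop]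
  by_cases hStop :
      sqrtSumNorm (fun n => (E (a n * star (a n) + star (a n) * a n) : H →L[ℂ] H)) = ⊤
  · rw [hStop, add_top]
    exact le_top
  obtain ⟨c, hc0, hceq, hc⟩ := exists_sum_le_of_sqrtSumNorm_ne_top h.map_add_nonneg hStop
  set B := (⨆ n, ‖(a n : H →L[ℂ] H)‖ₑ).toReal with hBdef
  have hB0 : 0 ≤ B := ENNReal.toReal_nonneg
  have hBeq : (⨆ n, ‖(a n : H →L[ℂ] H)‖ₑ) = ENNReal.ofReal B := (ENNReal.ofReal_toReal hBtop).symm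
  have hB : ∀ n, ‖(a n : H →L[ℂ] H)‖ ≤ B := fun n => by
    have := le_iSup (fun n => ‖(a n : H →L[ℂ] H)‖ₑ) n
    rwa [hBeq, ← ofReal_norm, ENNReal.ofReal_le_ofReal_iff hB0] at this
  have hB' : ∀ n, ‖((star (a n) : El M) : H →L[ℂ] H)‖ ≤ B := fun n =>
    (norm_star (a n : H →L[ℂ] H)).trans_le (hB n)
  have hcol : ∀ K, ((∑ n ∈ Finset.range K, E (star (a n) * a n) : El M) : H →L[ℂ] H) ≤
      (c ^ 2) • 1 := fun K =>
    (le_add_of_nonneg_left (h.adjoint.sum_nonneg K)).trans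
      ((sum_map_add E a K).symm.trans_le (hc K))
  have hrow : ∀ K, ((∑ n ∈ Finset.range K, E (star (star (a n)) * star (a n)) : El M) :
      H →L[ℂ] H) ≤ (c ^ 2) • 1 := fun K =>
    (le_add_of_nonneg_right (h.sum_nonneg K)).trans ((sum_map_add E a K).symm.trans_le (hc K))
  obtain ⟨x, hx⟩ := h.exists_tendsto_of_sum_le hcol
  rw [hceq, hBeq, ← ENNReal.ofReal_add hB0 hc0]
  exact (iInf₂_le x hx).trans (max_le (h.bmoCol_le hx hB0 hB hc0 hcol)
    (h.adjoint.bmoCol_le (tendsto_sum_starL2 hx) hB0 hB' hc0 hrow))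

theorem le_bmoOfSeries :
    (⨆ n, ‖(a n : H →L[ℂ] H)‖ₑ) +
        sqrtSumNorm (fun n => (E (a n * star (a n) + star (a n) * a n) : H →L[ℂ] H)) ≤
      3 * bmoOfSeries τ (genFiltration A) a := by
  by_cases hex : ∃ x : L2 τ, Tendsto (fun K => ∑ k ∈ Finset.range K, toL2 τ (a k)) atTop (𝓝 x)
  swap
  · have : bmoOfSeries τ (genFiltration A) a = ⊤ :=
      top_unique (le_iInf₂ fun x hx => absurd ⟨x, hx⟩ hex)
    simp [this]
  obtain ⟨x, hx⟩ := hex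
  have heq : bmoOfSeries τ (genFiltration A) a = bmo τ (genFiltration A) x :=
    le_antisymm (iInf₂_le x hx) (le_iInf₂ fun z hz => by rw [tendsto_nhds_unique hx hz])
  rw [heq]
  by_cases htop : bmo τ (genFiltration A) x = ⊤
  · simp [htop]
  set β := (bmo τ (genFiltration A) x).toReal with hβ
  have hβ0 : 0 ≤ β := ENNReal.toReal_nonneg
  have hβeq : bmo τ (genFiltration A) x = ENNReal.ofReal β := (ENNReal.ofReal_toReal htop).symm
  have hcol : bmoCol τ (genFiltration A) x ≤ ENNReal.ofReal β := (le_max_left _ _).trans_eq hβeq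
  have hrow : bmoCol τ (genFiltration A) (starL2 τ x) ≤ ENNReal.ofReal β :=
    (le_max_right _ _).trans_eq hβeq
  have h1 : (⨆ n, ‖(a n : H →L[ℂ] H)‖ₑ) ≤ ENNReal.ofReal β := iSup_le fun n => by
    rw [← ofReal_norm]
    exact ENNReal.ofReal_le_ofReal (h.norm_le_of_bmoCol_le hx hβ0 hcol n)
  have h2 : sqrtSumNorm (fun n => (E (a n * star (a n) + star (a n) * a n) : H →L[ℂ] H)) ≤
      ENNReal.ofReal (2 * β) := by
    refine sqrtSumNorm_le h.map_add_nonneg (by positivity) fun K => ?_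
    rw [sum_map_add E a K]
    refine (add_le_add
      (h.adjoint.sum_le_of_bmoCol_le (tendsto_sum_starL2 hx) hβ0 hrow K)
      (h.sum_le_of_bmoCol_le hx hβ0 hcol K)).trans ?_
    rw [← add_smul]
    exact smul_le_smul_of_nonneg_right (by nlinarith [sq_nonneg β]) zero_le_one
  calc _ ≤ ENNReal.ofReal β + ENNReal.ofReal (2 * β) := add_le_add h1 h2
    _ = 3 * bmo τ (genFiltration A) x := by
      rw [hβeq, ← ENNReal.ofReal_add hβ0 (by positivity),
        show (3 : ℝ≥0∞) = ENNReal.ofReal 3 by simp, ← ENNReal.ofReal_mul (by norm_num)]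
      congr 1
      ring

end IsCenteredIndep

/-! ### Scalar conditional expectations -/

section Scalar

variable {M N : VonNeumannAlgebra H} {τ : FiniteTrace M} {E : El M →ₗ[ℂ] El M}

theorem IsTraceCondExp.eq_trace_smul_one (hE : IsTraceCondExp τ N E)
    (hN : (N : Set (H →L[ℂ] H)) = Set.range (fun c : ℂ => c • (1 : H →L[ℂ] H)))
    (hτ : τ.toLin 1 = 1) (x : El M) : (E x : H →L[ℂ] H) = τ.toLin x • 1 := by
  obtain ⟨c, hc⟩ : (E x : H →L[ℂ] H) ∈ Set.range (fun c : ℂ => c • (1 : H →L[ℂ] H)) :=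
    hN ▸ hE.mem x
  have h1 : E x = c • 1 := Subtype.ext hc.symm
  have h2 := hE.trace_preserving x
  rw [h1, map_smul, hτ, smul_eq_mul, mul_one] at h2
  rw [← h2]
  exact hc.symm

theorem norm_toL2_sq (x : El M) : ‖toL2 τ x‖ ^ 2 = (τ.toLin (star x * x)).re := by
  rw [show ‖toL2 τ x‖ = ‖toPre τ x‖ from UniformSpace.Completion.norm_coe _]
  exact norm_sq_def τ (toPre τ x)

/-- For scalar `E`, both `E |a|²` and `E |a*|²` are `‖a‖₂² 1`. -/
theorem map_add_eq_smul_one (hE : IsTraceCondExp τ N E)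
    (hN : (N : Set (H →L[ℂ] H)) = Set.range (fun c : ℂ => c • (1 : H →L[ℂ] H)))
    (hτ : τ.toLin 1 = 1) (x : El M) :
    (E (x * star x + star x * x) : H →L[ℂ] H) = (2 * ‖toL2 τ x‖ ^ 2) • 1 := by
  have h1 : τ.toLin (star x * x) = ((‖toL2 τ x‖ ^ 2 : ℝ) : ℂ) := by
    refine Complex.ext ?_ ?_
    · rw [norm_toL2_sq, Complex.ofReal_re]
    · rw [Complex.ofReal_im]
      exact (Complex.le_def.1 (τ.nonneg _ (star_mul_self_nonneg' x))).2.symm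
  rw [hE.eq_trace_smul_one hN hτ, map_add, τ.tracial x, h1, ← Complex.coe_smul]
  congr 1
  push_cast
  ring

theorem sqrtSumNorm_scalar (hE : IsTraceCondExp τ N E)
    (hN : (N : Set (H →L[ℂ] H)) = Set.range (fun c : ℂ => c • (1 : H →L[ℂ] H)))
    (hτ : τ.toLin 1 = 1) (a : ℕ → El M) :
    (∑' n, ‖toL2 τ (a n)‖ₑ ^ 2) ^ (1 / 2 : ℝ) ≤
        sqrtSumNorm (fun n => (E (a n * star (a n) + star (a n) * a n) : H →L[ℂ] H)) ∧
      sqrtSumNorm (fun n => (E (a n * star (a n) + star (a n) * a n) : H →L[ℂ] H)) ≤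
        2 * (∑' n, ‖toL2 τ (a n)‖ₑ ^ 2) ^ (1 / 2 : ℝ) := by
  simp only [map_add_eq_smul_one hE hN hτ]
  have hb : ∀ n, 0 ≤ (2 * ‖toL2 τ (a n)‖ ^ 2) • (1 : H →L[ℂ] H) := fun n =>
    smul_nonneg (by positivity) zero_le_one
  have hpart : ∀ K, ∑ n ∈ Finset.range K, ‖toL2 τ (a n)‖ₑ ^ 2 =
      ENNReal.ofReal (∑ n ∈ Finset.range K, ‖toL2 τ (a n)‖ ^ 2) := fun K => by
    rw [ENNReal.ofReal_sum_of_nonneg fun _ _ => sq_nonneg _]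
    refine Finset.sum_congr rfl fun n _ => ?_
    rw [ENNReal.ofReal_pow (norm_nonneg _), ofReal_norm]
  constructor
  · by_cases htop : sqrtSumNorm (fun n => (2 * ‖toL2 τ (a n)‖ ^ 2) • (1 : H →L[ℂ] H)) = ⊤
    · simp [htop]
    obtain ⟨c, hc0, hceq, hc⟩ := exists_sum_le_of_sqrtSumNorm_ne_top hb htop
    have hnt : Nontrivial (H →L[ℂ] H) := by
      -- On the zero space `1 = 0`, contradicting `τ 1 = 1`.
      by_contra hne
      rw [not_nontrivial_iff_subsingleton] at hne
      have : (1 : El M) = 0 := Subtype.ext (Subsingleton.elim _ _)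
      rw [this, map_zero] at hτ
      exact zero_ne_one hτ
    rw [hceq, rpow_half_le_iff, ENNReal.tsum_eq_iSup_nat]
    refine iSup_le fun K => ?_
    rw [hpart, ← ENNReal.ofReal_pow hc0]
    refine ENNReal.ofReal_le_ofReal ?_
    have h1 := hc K
    rw [← Finset.sum_smul, ← Finset.mul_sum] at h1
    have hS : 0 ≤ ∑ n ∈ Finset.range K, ‖toL2 τ (a n)‖ ^ 2 :=
      Finset.sum_nonneg fun _ _ => sq_nonneg _
    have h2 := norm_le_of_le_smul_one (by positivity)
      (smul_nonneg (by positivity) zero_le_one) h1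
    rw [norm_smul, norm_one, mul_one, Real.norm_of_nonneg (by positivity)] at h2
    linarith
  · by_cases htop : (∑' n, ‖toL2 τ (a n)‖ₑ ^ 2) ^ (1 / 2 : ℝ) = ⊤
    · rw [htop, ENNReal.mul_top two_ne_zero]
      exact le_top
    set t := ((∑' n, ‖toL2 τ (a n)‖ₑ ^ 2) ^ (1 / 2 : ℝ)).toReal with ht
    have ht0 : 0 ≤ t := ENNReal.toReal_nonneg
    have hteq : (∑' n, ‖toL2 τ (a n)‖ₑ ^ 2) ^ (1 / 2 : ℝ) = ENNReal.ofReal t :=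
      (ENNReal.ofReal_toReal htop).symm
    rw [hteq, show (2 : ℝ≥0∞) = ENNReal.ofReal 2 by simp, ← ENNReal.ofReal_mul (by norm_num)]
    refine sqrtSumNorm_le hb (by positivity) fun K => ?_
    have h1 := (ENNReal.sum_le_tsum (Finset.range K)).trans (rpow_half_le_iff.1 hteq.le)
    rw [hpart, ← ENNReal.ofReal_pow ht0, ENNReal.ofReal_le_ofReal_iff (by positivity)] at h1
    rw [← Finset.sum_smul, ← Finset.mul_sum]
    exact smul_le_smul_of_nonneg_right (by nlinarith [sq_nonneg t]) zero_le_one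

end Scalar

end NCBMO

theorem theorem5p3 :
    ∃ C : NNReal, 0 < C ∧
      ∀ (H : Type*) [NormedAddCommGroup H] [InnerProductSpace ℂ H] [CompleteSpace H]
        (M : VonNeumannAlgebra H) (τ : NCBMO.FiniteTrace M)
        (N : VonNeumannAlgebra H) (E : NCBMO.El M →ₗ[ℂ] NCBMO.El M)
        (_ : NCBMO.IsTraceCondExp τ N E)
        (A : ℕ → VonNeumannAlgebra H) (_ : NCBMO.IsOrderIndependent E A) (_ : N ≤ A 0)
        (a : ℕ → NCBMO.El M) (_ : ∀ n, (a n : H →L[ℂ] H) ∈ A n) (_ : ∀ n, E (a n) = 0),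
        (NCBMO.bmoOfSeries τ (NCBMO.genFiltration A) a ≤
            C * ((⨆ n, ‖(a n : H →L[ℂ] H)‖ₑ) + NCBMO.sqrtSumNorm
              (fun n => (E (a n * star (a n) + star (a n) * a n) : H →L[ℂ] H))) ∧
          (⨆ n, ‖(a n : H →L[ℂ] H)‖ₑ) + NCBMO.sqrtSumNorm
              (fun n => (E (a n * star (a n) + star (a n) * a n) : H →L[ℂ] H)) ≤
            C * NCBMO.bmoOfSeries τ (NCBMO.genFiltration A) a) ∧
        ((N : Set (H →L[ℂ] H)) = Set.range (fun c : ℂ => c • (1 : H →L[ℂ] H)) →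
          τ.toLin 1 = 1 →
          NCBMO.bmoOfSeries τ (NCBMO.genFiltration A) a ≤
              C * ((⨆ n, ‖(a n : H →L[ℂ] H)‖ₑ) +
                (∑' n, ‖NCBMO.toL2 τ (a n)‖ₑ ^ 2) ^ (1 / 2 : ℝ)) ∧
          (⨆ n, ‖(a n : H →L[ℂ] H)‖ₑ) + (∑' n, ‖NCBMO.toL2 τ (a n)‖ₑ ^ 2) ^ (1 / 2 : ℝ) ≤
              C * NCBMO.bmoOfSeries τ (NCBMO.genFiltration A) a) := by
  refine ⟨3, by norm_num, fun H _ _ _ M τ N E hE A hA hN a ha hEa => ?_⟩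
  have h : NCBMO.IsCenteredIndep τ N E A a := ⟨hE, hA, hN, ha, hEa⟩
  have h3 : ((3 : NNReal) : ℝ≥0∞) = 3 := rfl
  rw [h3]
  refine ⟨⟨h.bmoOfSeries_le.trans (le_mul_of_one_le_left' (by norm_num)), h.le_bmoOfSeries⟩,
    fun hNs hτ => ?_⟩
  obtain ⟨hle, hge⟩ := NCBMO.sqrtSumNorm_scalar hE hNs hτ a
  refine ⟨h.bmoOfSeries_le.trans ?_, (add_le_add le_rfl hle).trans h.le_bmoOfSeries⟩
  rw [mul_add]
  refine add_le_add (le_mul_of_one_le_left' (by norm_num)) (hge.trans ?_)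
  gcongr
  norm_num
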